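/- **Theorem (Graph Linear Programming is undecidable).** A *graph* $\mathcal G=(V,D,L)$ of dimension $n$ consists of a finite set $V$ of nodes, a symmetric set $D\subseteq V\times V$ of edges (loops allowed) and a labelling $L:V\to\mathbb R^n$; put $N_v=\{v'\in V\mid (v,v')\in D\}$. A *node condition* over the variables $x_1,\dots,x_n$ is a formula built with $\wedge$ and $\vee$ (no negation) from inequalities $$\sum_{i=1}^n \bigl(a_i x_i+b_i(\odot x_i)\bigr)\le c,\qquad a_i,b_i,c\in\mathbb Q .$$ A node $v$ of $\mathcal G$ satisfies such an inequality iff $\sum_{i=1}^n \bigl(a_iL(v)_i+b_i\sum_{v'\in N_v}L(v')_i\bigr)\le c$; $\wedge$ and $\vee$ are read as "and" and "or". A *graph condition* over $x_1,\dots,x_n$ is a finite non-empty conjunction of inequalities $\sum_{i=1}^n a_ix_i\le c$ with $a_i,c\in\mathbb Q$; $\mathcal G$ satisfies such an inequality iff $\sum_{i=1}^n a_i\sum_{v\in V}L(v)_i\le c$, and it satisfies the conjunction iff it satisfies every conjunct. The problem GLP is: given $n$, a graph condition $\psi$ and a node condition $\varphi$ over the same variables $x_1,\dots,x_n$ (as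 finite words, in prefix notation), decide whether there is a graph $\mathcal G$ of dimension $n$ that satisfies $\psi$ and all of whose nodes satisfy $\varphi$. GLP is undecidable: there is no algorithm (total computable function) that, on every such input $(n,\psi,\varphi)$, correctly answers whether such a graph exists. -/

import Mathlib

namespace GLP

/-! ### Labelled graphs -/

/-- A finite undirected graph whose nodes carry labels in `ℝⁿ`.  The edge set is an arbitrary
symmetric set of pairs of nodes; in particular an edge from a node to itself is allowed. -/
structure LabeledGraph (n : ℕ) where
  /-- the nodes -/
  V : Type
  /-- there are finitely many nodes -/
  [fintypeV : Fintype V]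
  /-- the edge relation -/
  Adj : V → V → Prop
  /-- edges are undirected -/
  symm : ∀ v w, Adj v w → Adj w v
  /-- the label of a node -/
  label : V → Fin n → ℝ

attribute [instance] LabeledGraph.fintypeV

open Classical in
/-- Coordinate `i` of the sum of the labels of all neighbours of `v`. -/
noncomputable def LabeledGraph.neighSum {n : ℕ} (G : LabeledGraph n) (v : G.V) (i : Fin n) : ℝ :=
  ∑ w ∈ Finset.univ.filter (fun w => G.Adj v w), G.label w i

/-- Coordinate `i` of the sum of the labels of all nodes. -/
noncomputable def LabeledGraph.totalSum {n : ℕ} (G : LabeledGraph n) (i : Fin n) : ℝ :=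
  ∑ v : G.V, G.label v i

/-! ### Node conditions and graph conditions -/

/-- Node conditions over the variables `x₁, …, xₙ`. -/
inductive NodeCond (n : ℕ) : Type
  /-- the inequality `∑ i, (a i * xᵢ + b i * ⊙ xᵢ) ≤ c` -/
  | le (a b : Fin n → ℚ) (c : ℚ) : NodeCond n
  | and (φ₁ φ₂ : NodeCond n) : NodeCond n
  | or (φ₁ φ₂ : NodeCond n) : NodeCond n

/-- The node `v` of `G` satisfies a node condition. -/
def NodeCond.Holds {n : ℕ} (G : LabeledGraph n) (v : G.V) : NodeCond n → Prop
  | .le a b c => ∑ i, ((a i : ℝ) * G.label v i + (b i : ℝ) * G.neighSum v i) ≤ (c : ℝ)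
  | .and φ₁ φ₂ => φ₁.Holds G v ∧ φ₂.Holds G v
  | .or φ₁ φ₂ => φ₁.Holds G v ∨ φ₂.Holds G v

/-- Graph conditions over the variables `x₁, …, xₙ`. -/
inductive GraphCond (n : ℕ) : Type
  /-- the inequality `∑ i, a i * xᵢ ≤ c` -/
  | le (a : Fin n → ℚ) (c : ℚ) : GraphCond n
  | and (ψ₁ ψ₂ : GraphCond n) : GraphCond n

/-- The graph `G` satisfies a graph condition. -/
def GraphCond.Holds {n : ℕ} (G : LabeledGraph n) : GraphCond n → Prop
  | .le a c => ∑ i, (a i : ℝ) * G.totalSum i ≤ (c : ℝ)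
  | .and ψ₁ ψ₂ => ψ₁.Holds G ∧ ψ₂.Holds G

/-- A graph linear program: a graph condition and a node condition over the same variables. -/
structure Program where
  /-- the number of variables -/
  n : ℕ
  /-- the graph condition -/
  graphCond : GraphCond n
  /-- the node condition -/
  nodeCond : NodeCond n

/-- Some graph satisfies the graph condition, and all its nodes satisfy the node condition. -/
def Program.Satisfiable (P : Program) : Prop :=
  ∃ G : LabeledGraph P.n, P.graphCond.Holds G ∧ ∀ v : G.V, P.nodeCond.Holds G v

/-! ### Graph linear programs as finite words

To be the input of an algorithm, a program is written in prefix notation as a finite list of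
natural numbers. -/

/-- A rational number is written as the positive part of its numerator, the negative part of its
numerator, and its denominator (in lowest terms). -/
def ratCode (q : ℚ) : List ℕ := [q.num.toNat, (-q.num).toNat, q.den]

/-- A vector of rational numbers is written coordinate by coordinate. -/
def vecCode {n : ℕ} (a : Fin n → ℚ) : List ℕ := (List.ofFn a).flatMap ratCode

/-- Prefix notation of a node condition. -/
def NodeCond.code {n : ℕ} : NodeCond n → List ℕ
  | .le a b c => 0 :: (vecCode a ++ (vecCode b ++ ratCode c))
  | .and φ₁ φ₂ => 1 :: (φ₁.code ++ φ₂.code)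
  | .or φ₁ φ₂ => 2 :: (φ₁.code ++ φ₂.code)

/-- Prefix notation of a graph condition. -/
def GraphCond.code {n : ℕ} : GraphCond n → List ℕ
  | .le a c => 0 :: (vecCode a ++ ratCode c)
  | .and ψ₁ ψ₂ => 1 :: (ψ₁.code ++ ψ₂.code)

/-- The word that represents a graph linear program. -/
def Program.code (P : Program) : List ℕ :=
  P.n :: (P.graphCond.code ++ P.nodeCond.code)

theorem ratCode_injective : Function.Injective ratCode := by
  intro p q h
  simp only [ratCode, List.cons.injEq, and_true] at h
  obtain ⟨h₁, h₂, h₃⟩ := h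
  exact Rat.ext (by omega) h₃

theorem ratCode_append {p q : ℚ} {r s : List ℕ} (h : ratCode p ++ r = ratCode q ++ s) :
    p = q ∧ r = s := by
  obtain ⟨h₁, h₂⟩ := List.append_inj h (by simp [ratCode])
  exact ⟨ratCode_injective h₁, h₂⟩

theorem vecCode_append {n : ℕ} {a b : Fin n → ℚ} {r s : List ℕ}
    (h : vecCode a ++ r = vecCode b ++ s) : a = b ∧ r = s := by
  induction n with
  | zero => exact ⟨Subsingleton.elim _ _, by simpa [vecCode] using h⟩
  | succ n ih =>
    simp only [vecCode, List.ofFn_succ, List.flatMap_cons, List.append_assoc] at h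
    obtain ⟨h₀, h'⟩ := ratCode_append h
    obtain ⟨h₁, h₂⟩ := ih (a := fun i => a i.succ) (b := fun i => b i.succ) h'
    refine ⟨funext fun i => ?_, h₂⟩
    cases i using Fin.cases with
    | zero => exact h₀
    | succ i => exact congrFun h₁ i

theorem NodeCond.code_append {n : ℕ} {φ χ : NodeCond n} {r s : List ℕ}
    (h : φ.code ++ r = χ.code ++ s) : φ = χ ∧ r = s := by
  induction φ generalizing χ r s with
  | le a b c =>
    cases χ <;> simp [NodeCond.code] at h
    obtain ⟨rfl, h₁⟩ := vecCode_append h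
    obtain ⟨rfl, h₂⟩ := vecCode_append h₁
    obtain ⟨rfl, h₃⟩ := ratCode_append h₂
    exact ⟨rfl, h₃⟩
  | and φ₁ φ₂ ih₁ ih₂ =>
    cases χ <;> simp [NodeCond.code] at h
    obtain ⟨rfl, h₁⟩ := ih₁ h
    obtain ⟨rfl, h₂⟩ := ih₂ h₁
    exact ⟨rfl, h₂⟩
  | or φ₁ φ₂ ih₁ ih₂ =>
    cases χ <;> simp [NodeCond.code] at h
    obtain ⟨rfl, h₁⟩ := ih₁ h
    obtain ⟨rfl, h₂⟩ := ih₂ h₁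
    exact ⟨rfl, h₂⟩

theorem GraphCond.code_append {n : ℕ} {ψ χ : GraphCond n} {r s : List ℕ}
    (h : ψ.code ++ r = χ.code ++ s) : ψ = χ ∧ r = s := by
  induction ψ generalizing χ r s with
  | le a c =>
    cases χ <;> simp [GraphCond.code] at h
    obtain ⟨rfl, h₁⟩ := vecCode_append h
    obtain ⟨rfl, h₂⟩ := ratCode_append h₁
    exact ⟨rfl, h₂⟩
  | and ψ₁ ψ₂ ih₁ ih₂ =>
    cases χ <;> simp [GraphCond.code] at h
    obtain ⟨rfl, h₁⟩ := ih₁ h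
    obtain ⟨rfl, h₂⟩ := ih₂ h₁
    exact ⟨rfl, h₂⟩

/-- Different programs are represented by different words. -/
theorem Program.code_injective : Function.Injective Program.code := by
  rintro ⟨n, ψ, φ⟩ ⟨m, ψ', φ'⟩ h
  simp only [Program.code, List.cons.injEq] at h
  obtain ⟨rfl, h⟩ := h
  obtain ⟨rfl, h⟩ := GraphCond.code_append h
  obtain ⟨rfl, -⟩ := NodeCond.code_append (r := []) (s := []) (by simpa using h)
  rfl

/-! ### Decidability -/

/-- The problem `p` on objects that are represented by words is decidable: some total recursive
function gives the correct answer on the word of every object.  (No condition is put on its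
answers on words that represent no object.) -/
def IsDecidable {α : Type} (code : α → List ℕ) (p : α → Prop) : Prop :=
  ∃ f : List ℕ → Bool, Computable f ∧ ∀ x, f (code x) = true ↔ p x

end GLP

/-!
A configuration of a machine with several stacks is a real vector: one coordinate numbers the
control state, and each stack is the expansion of a rational number in a large base. The top symbol
of a stack can be read off with linear inequalities, because a tail contributes at most `1 / 2`,
and pushing and popping are affine maps. Hence the steps of the machine form a polyhedral relation.

A terminating run is represented by a path graph. A node condition only sees the sum of the labels
of all neighbours, so each node is coloured by its position modulo `3` and stores its data in a
block of coordinates reserved for its colour. If the indicators of the next colour sum to `1`, then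
exactly one neighbour has that colour, and its data are the sums of the block. The node condition
demands a step to this neighbour and a decrease of the rank by at least `1`; in a finite graph the
rank cannot decrease forever, so every solution contains a terminating run from the marked node.

The undecidable problem is whether a partial recursive function is defined at `t`. On input `2 ^ t`
the initial stack consists of `t` equal symbols and a fixed rest, so the initial vector is affine
in `B ^ (-t)`, where `B` is the base. Hence only the constant of one linear equation in the program
depends on `t`, and the program is a primitive recursive function of `t`.
-/

namespace GLP

open Function Relation

/-! ### Polyhedral predicates -/

section Polyhedral

variable {ι κ σ : Type*} {f g : (ι → ℝ) → ℝ} {p q : (ι → ℝ) → Prop}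

/-- Affine functions with rational coefficients; they involve only finitely many coordinates, even
if `ι` is infinite. -/
inductive IsRatAffine : ((ι → ℝ) → ℝ) → Prop
  | const (c : ℚ) : IsRatAffine fun _ => c
  | coord (i : ι) : IsRatAffine fun x => x i
  | add {f g : (ι → ℝ) → ℝ} : IsRatAffine f → IsRatAffine g → IsRatAffine fun x => f x + g x
  | smul (c : ℚ) {f : (ι → ℝ) → ℝ} : IsRatAffine f → IsRatAffine fun x => c * f x

theorem sum_single_mul [Fintype ι] [DecidableEq ι] (i : ι) (c : ℚ) (x : ι → ℝ) :
    ∑ j, ((Pi.single i c : ι → ℚ) j : ℝ) * x j = c * x i := by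
  rw [Finset.sum_eq_single i] <;> simp +contextual

namespace IsRatAffine

theorem natCast (n : ℕ) : IsRatAffine fun _ : ι → ℝ => (n : ℝ) := by
  simpa using const (ι := ι) n

theorem sub (hf : IsRatAffine f) (hg : IsRatAffine g) : IsRatAffine fun x => f x - g x := by
  simpa [sub_eq_add_neg] using hf.add (hg.smul (-1))

theorem comp (hf : IsRatAffine f) {h : (κ → ℝ) → ι → ℝ} (hh : ∀ i, IsRatAffine fun x => h x i) :
    IsRatAffine fun x => f (h x) := by
  induction hf with
  | const c => exact const c
  | coord i => exact hh i
  | add _ _ ih₁ ih₂ => exact ih₁.add ih₂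
  | smul c _ ih => exact ih.smul c

theorem update [DecidableEq κ] {h : (ι → ℝ) → κ → ℝ} (hh : ∀ i, IsRatAffine fun x => h x i)
    (k : κ) (hf : IsRatAffine f) (i : κ) : IsRatAffine fun x => update (h x) k (f x) i := by
  obtain rfl | hi := eq_or_ne i k
  · simpa only [update_self] using hf
  · simpa only [update_of_ne hi] using hh i

theorem exists_eq_sum [Fintype ι] (hf : IsRatAffine f) :
    ∃ (a : ι → ℚ) (c : ℚ), ∀ x, f x = ∑ i, (a i : ℝ) * x i + c := by
  classical
  induction hf with
  | const c => exact ⟨0, c, by simp⟩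
  | coord i => exact ⟨Pi.single i 1, 0, fun x => by simp [sum_single_mul]⟩
  | add _ _ ih₁ ih₂ =>
    obtain ⟨⟨a, c, h₁⟩, b, d, h₂⟩ := ih₁, ih₂
    refine ⟨a + b, c + d, fun x => ?_⟩
    simp only [h₁, h₂, Pi.add_apply, Rat.cast_add, add_mul, Finset.sum_add_distrib]
    ring
  | smul q _ ih =>
    obtain ⟨a, c, h⟩ := ih
    refine ⟨q • a, q * c, fun x => ?_⟩
    simp [h, mul_add, Finset.mul_sum, mul_assoc]

end IsRatAffine

/-- Predicates that are positive Boolean combinations of linear inequalities with rational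
coefficients, that is, that define finite unions of rational polyhedra. -/
inductive IsPolyhedral : ((ι → ℝ) → Prop) → Prop
  | le {f g : (ι → ℝ) → ℝ} : IsRatAffine f → IsRatAffine g → IsPolyhedral fun x => f x ≤ g x
  | and {p q : (ι → ℝ) → Prop} : IsPolyhedral p → IsPolyhedral q → IsPolyhedral fun x => p x ∧ q x
  | or {p q : (ι → ℝ) → Prop} : IsPolyhedral p → IsPolyhedral q → IsPolyhedral fun x => p x ∨ q x

namespace IsPolyhedral

theorem eq (hf : IsRatAffine f) (hg : IsRatAffine g) : IsPolyhedral fun x => f x = g x := by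
  simpa only [le_antisymm_iff] using (le hf hg).and (le hg hf)

theorem const (P : Prop) : IsPolyhedral fun _ : ι → ℝ => P := by
  by_cases hP : P
  · simpa [hP] using le (IsRatAffine.natCast (ι := ι) 0) (.natCast 0)
  · simpa [hP, not_le.2 (one_pos (α := ℝ))] using
      le (IsRatAffine.natCast (ι := ι) 1) (.natCast 0)

theorem imp (P : Prop) (hp : IsPolyhedral p) : IsPolyhedral fun x => P → p x := by
  simpa only [imp_iff_not_or] using (const (¬P)).or hp

theorem comp (hp : IsPolyhedral p) {h : (κ → ℝ) → ι → ℝ} (hh : ∀ i, IsRatAffine fun x => h x i) :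
    IsPolyhedral fun x => p (h x) := by
  induction hp with
  | le hf hg => exact le (hf.comp hh) (hg.comp hh)
  | and _ _ ih₁ ih₂ => exact ih₁.and ih₂
  | or _ _ ih₁ ih₂ => exact ih₁.or ih₂

theorem forall_finite [Finite σ] {p : σ → (ι → ℝ) → Prop} (hp : ∀ s, IsPolyhedral (p s)) :
    IsPolyhedral fun x => ∀ s, p s x := by
  induction σ using Finite.induction_empty_option with
  | of_equiv e ih => simpa only [← e.forall_congr_right] using ih fun s => hp (e s)
  | h_empty => simpa using const True
  | h_option ih => simpa only [Option.forall] using (hp none).and (ih fun s => hp (some s))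

theorem exists_finite [Finite σ] {p : σ → (ι → ℝ) → Prop} (hp : ∀ s, IsPolyhedral (p s)) :
    IsPolyhedral fun x => ∃ s, p s x := by
  induction σ using Finite.induction_empty_option with
  | of_equiv e ih => simpa only [← e.exists_congr_right] using ih fun s => hp (e s)
  | h_empty => simpa using const False
  | h_option ih => simpa only [Option.exists] using (hp none).or (ih fun s => hp (some s))

theorem exists_nodeCond {n : ℕ} {p : (Fin n ⊕ Fin n → ℝ) → Prop} (hp : IsPolyhedral p) :
    ∃ φ : NodeCond n, ∀ (G : LabeledGraph n) (v : G.V),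
      φ.Holds G v ↔ p (Sum.elim (G.label v) (G.neighSum v)) := by
  induction hp with
  | le hf hg =>
    obtain ⟨a, c, h⟩ := (hf.sub hg).exists_eq_sum
    refine ⟨.le (a ∘ .inl) (a ∘ .inr) (-c), fun G v => ?_⟩
    beta_reduce
    rw [← sub_nonpos, h, NodeCond.Holds, Fintype.sum_sum_type, Finset.sum_add_distrib]
    push_cast
    exact le_neg_iff_add_nonpos_right
  | and _ _ ih₁ ih₂ =>
    obtain ⟨⟨φ, hφ⟩, χ, hχ⟩ := ih₁, ih₂
    exact ⟨.and φ χ, fun G v => and_congr (hφ G v) (hχ G v)⟩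
  | or _ _ ih₁ ih₂ =>
    obtain ⟨⟨φ, hφ⟩, χ, hχ⟩ := ih₁, ih₂
    exact ⟨.or φ χ, fun G v => or_congr (hφ G v) (hχ G v)⟩

end IsPolyhedral

/-- The relations between two vectors that are polyhedral in the pair of both vectors. -/
def IsPolyhedralRel (r : (ι → ℝ) → (κ → ℝ) → Prop) : Prop :=
  IsPolyhedral fun x : ι ⊕ κ → ℝ => r (fun i => x (.inl i)) fun k => x (.inr k)

theorem IsPolyhedralRel.comp {r : (ι → ℝ) → (κ → ℝ) → Prop} (hr : IsPolyhedralRel r)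
    {f : (σ → ℝ) → ι → ℝ} {g : (σ → ℝ) → κ → ℝ} (hf : ∀ i, IsRatAffine fun x => f x i)
    (hg : ∀ k, IsRatAffine fun x => g x k) : IsPolyhedral fun x => r (f x) (g x) :=
  IsPolyhedral.comp hr (h := fun x => Sum.elim (f x) (g x)) (Sum.rec hf hg)

end Polyhedral

/-! ### Runs as graphs -/

section Run

/-- Some sequence of `step`s leads from `a` to an element with property `halt`. -/
def Terminates {α : Type*} (step : α → α → Prop) (halt : α → Prop) (a : α) : Prop :=
  ∃ b, ReflTransGen step a b ∧ halt b

theorem terminates_map_iff {α β : Type*} {r : α → α → Prop} {s : β → β → Prop} {p : α → Prop}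
    {q : β → Prop} {f : α → β} {inv : α → Prop} (hinv : ∀ {a b}, inv a → r a b → inv b)
    (hs : ∀ {a}, inv a → ∀ y, s (f a) y ↔ ∃ b, r a b ∧ y = f b)
    (hq : ∀ {a}, inv a → (q (f a) ↔ p a)) {a : α} (ha : inv a) :
    Terminates s q (f a) ↔ Terminates r p a := by
  constructor
  · rintro ⟨y, hy, hqy⟩
    suffices h : ∃ b, ReflTransGen r a b ∧ inv b ∧ y = f b by
      obtain ⟨b, hab, hb, rfl⟩ := h
      exact ⟨b, hab, (hq hb).1 hqy⟩
    clear hqy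
    induction hy with
    | refl => exact ⟨a, .refl, ha, rfl⟩
    | tail _ hyz ih =>
      obtain ⟨b, hab, hb, rfl⟩ := ih
      obtain ⟨c, hbc, rfl⟩ := (hs hb _).1 hyz
      exact ⟨c, hab.tail hbc, hinv hb hbc, rfl⟩
  · rintro ⟨b, hab, hb⟩
    induction hab using ReflTransGen.head_induction_on with
    | refl => exact ⟨_, .refl, (hq ha).2 hb⟩
    | head hac _ ih =>
      obtain ⟨y, hy, hqy⟩ := ih (hinv ha hac)
      exact ⟨y, .head ((hs ha _).2 ⟨_, hac, rfl⟩) hy, hqy⟩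

theorem terminates_of_rank {α V : Type*} [Finite V] {step : α → α → Prop} {halt : α → Prop}
    (f : V → α) (rank : V → ℝ)
    (h : ∀ v, halt (f v) ∨ ∃ w, rank w < rank v ∧ step (f v) (f w)) (v : V) :
    Terminates step halt (f v) := by
  have wf : WellFounded (InvImage (· < ·) rank) := Finite.wellFounded_of_trans_of_irrefl _
  induction v using wf.induction with
  | _ v ih =>
    obtain hv | ⟨w, hw, hvw⟩ := h v
    · exact ⟨f v, .refl, hv⟩
    · obtain ⟨b, hb, hb'⟩ := ih w hw
      exact ⟨b, .head hvw hb, hb'⟩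

theorem exists_seq_of_reflTransGen {α : Type*} {r : α → α → Prop} {a b : α}
    (h : ReflTransGen r a b) :
    ∃ (m : ℕ) (x : ℕ → α), x 0 = a ∧ x m = b ∧ ∀ i < m, r (x i) (x (i + 1)) := by
  induction h using ReflTransGen.head_induction_on with
  | refl => exact ⟨0, fun _ => b, rfl, rfl, by simp⟩
  | @head a c hac _ ih =>
    obtain ⟨m, x, rfl, rfl, hx⟩ := ih
    refine ⟨m + 1, fun | 0 => a | i + 1 => x i, rfl, rfl, fun i hi => ?_⟩
    cases i with
    | zero => exact hac
    | succ i => exact hx i (by omega)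

theorem LabeledGraph.exists_neighSum_eq_label {n : ℕ} {κ : Type*} {G : LabeledGraph n} {v : G.V}
    (k : κ → Fin n) (o : κ) (h : ∀ w, G.label w (k o) = 1 ∨ ∀ i, G.label w (k i) = 0)
    (hv : G.neighSum v (k o) = 1) :
    ∃ w, G.label w (k o) = 1 ∧ ∀ i, G.neighSum v (k i) = G.label w (k i) := by
  classical
  let s : Finset G.V := {w | G.Adj v w ∧ G.label w (k o) = 1}
  have hsum (i : κ) : G.neighSum v (k i) = ∑ w ∈ s, G.label w (k i) := by
    rw [LabeledGraph.neighSum]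
    refine (Finset.sum_subset (by intro w; simp +contextual [s]) fun w hw hws => ?_).symm
    refine (h w).elim (fun h₁ => ?_) fun h₀ => h₀ i
    simp_all [s]
  obtain ⟨w, hw⟩ : ∃ w, s = {w} := by
    rw [← Finset.card_eq_one, ← Nat.cast_inj (R := ℝ), Nat.cast_one, ← hv, hsum, ← nsmul_one,
      ← Finset.sum_const]
    exact Finset.sum_congr rfl fun w hw => by simp_all [s]
  refine ⟨w, ?_, fun i => by rw [hsum, hw, Finset.sum_singleton]⟩
  have : w ∈ s := by simp [hw]
  simp_all [s]

variable {ι : Type*}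

/-- The coordinates of a graph that represents a run through vectors in `ℝ^ι`: the input, the mark
of the start node, and for every colour in `ZMod 3` a block that is zero at the nodes of another
colour.  The block holds an indicator of the colour, a rank that decreases along the run, and the
current vector.  Thus the sum of a block over the neighbours of a node is the content of its unique
neighbour of that colour, once the indicators sum to `1`. -/
abbrev RunCoord (ι : Type*) := Bool ⊕ ZMod 3 × Option (Option ι)

namespace RunCoord

/-- The coordinate that holds the input. -/
abbrev input : RunCoord ι := .inl false

/-- The coordinate that marks the start node. -/
abbrev root : RunCoord ι := .inl true

/-- The coordinate that indicates the colour `c`. -/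
abbrev indicator (c : ZMod 3) : RunCoord ι := .inr (c, none)

/-- The coordinate that holds the rank of a node of colour `c`. -/
abbrev rank (c : ZMod 3) : RunCoord ι := .inr (c, some none)

/-- The coordinates that hold the vector at a node of colour `c`. -/
abbrev state (c : ZMod 3) (i : ι) : RunCoord ι := .inr (c, some (some i))

end RunCoord

open RunCoord

variable {step : (ι → ℝ) → (ι → ℝ) → Prop} {halt : (ι → ℝ) → Prop} {a b : ι → ℚ}

/-- The condition on the label `x` of a node and the sum `y` of the labels of its neighbours in a
graph that represents a run from the vector `a + q b` with input `q`. -/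
def IsRunNode (step : (ι → ℝ) → (ι → ℝ) → Prop) (halt : (ι → ℝ) → Prop) (a b : ι → ℚ)
    (x y : RunCoord ι → ℝ) : Prop :=
  ∃ c : ZMod 3, x (indicator c) = 1 ∧ (∀ d, d ≠ c → ∀ o, x (.inr (d, o)) = 0) ∧
    (x root = 0 ∨ ∀ i, x (state c i) = a i + b i * x input) ∧
    (halt (fun i => x (state c i)) ∨
      y (indicator (c + 1)) = 1 ∧ y (rank (c + 1)) + 1 ≤ x (rank c) ∧
        step (fun i => x (state c i)) fun i => y (state (c + 1) i))

theorem isPolyhedralRel_isRunNode [Finite ι] (hs : IsPolyhedralRel step) (hh : IsPolyhedral halt) :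
    IsPolyhedralRel (IsRunNode step halt a b) := by
  have one (ι : Type _) : IsRatAffine fun _ : ι → ℝ => (1 : ℝ) := by
    simpa using IsRatAffine.natCast 1
  have zero (ι : Type _) : IsRatAffine fun _ : ι → ℝ => (0 : ℝ) := by
    simpa using IsRatAffine.natCast 0
  refine .exists_finite fun c => .and (.eq (.coord _) (one _)) <| .and
    (.forall_finite fun d => .imp _ <| .forall_finite fun o => .eq (.coord _) (zero _)) <|
    .and (.or (.eq (.coord _) (zero _)) <| .forall_finite fun i =>
      .eq (.coord _) (.add (.const _) (.smul _ (.coord _)))) <|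
    .or (hh.comp fun i => .coord _) <| .and (.eq (.coord _) (one _)) <|
    .and (.le (.add (.coord _) (one _)) (.coord _)) <| hs.comp (fun i => .coord _) fun i => .coord _

theorem terminates_of_isRunNode {n : ℕ} {G : LabeledGraph n} {e : RunCoord ι → Fin n} {q : ℝ}
    (h : ∀ v, IsRunNode step halt a b (fun k => G.label v (e k)) fun k => G.neighSum v (e k))
    (hroot : ∃ v, G.label v (e root) ≠ 0) (hq : ∀ v, G.label v (e input) = q) :
    Terminates step halt fun i => a i + b i * q := by
  choose c hc hne hstart hnext using h
  obtain ⟨v, hv⟩ := hroot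
  have hcolour {d : ZMod 3} {w : G.V} (hw : G.label w (e (indicator d)) = 1) : c w = d := by
    by_contra hd
    exact one_ne_zero (hw.symm.trans (hne w d (Ne.symm hd) none))
  have hrun := terminates_of_rank (step := step) (halt := halt)
    (fun w i => G.label w (e (state (c w) i))) (fun w => G.label w (e (rank (c w))))
    (fun w => (hnext w).imp_right ?_) v
  · simpa only [(hstart v).resolve_left hv, hq] using hrun
  · rintro ⟨h₁, h₂, h₃⟩
    have hblock (u : G.V) : G.label u (e (indicator (c w + 1))) = 1 ∨
        ∀ o, G.label u (e (.inr (c w + 1, o))) = 0 := by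
      by_cases hd : c w + 1 = c u
      · exact .inl (hd ▸ hc u)
      · exact .inr (hne u _ hd)
    obtain ⟨u, hu, hsum⟩ :=
      G.exists_neighSum_eq_label (fun o => e (.inr (c w + 1, o))) none hblock h₁
    simp only [hsum] at h₂ h₃
    rw [← hcolour hu] at h₂ h₃
    exact ⟨u, by linarith, h₃⟩

/-- The label of node `j` on the path graph of the run `x` of length `m` with input `q`. -/
noncomputable def runLabel (q : ℝ) (m : ℕ) (x : ℕ → ι → ℝ) (j : ℕ) : RunCoord ι → ℝ
  | .inl false => q
  | .inl true => if j = 0 then 1 else 0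
  | .inr (c, o) => if (j : ZMod 3) = c then o.elim 1 fun o => o.elim (m - j) (x j) else 0

/-- The path graph of the run `x` of length `m` with input `q`. -/
noncomputable abbrev runGraph {n : ℕ} (e : RunCoord ι ≃ Fin n) (q : ℝ) (m : ℕ) (x : ℕ → ι → ℝ) :
    LabeledGraph n where
  V := Fin (m + 1)
  Adj i j := (i : ℕ) + 1 = j ∨ (j : ℕ) + 1 = i
  symm _ _ := Or.symm
  label j k := runLabel q m x j (e.symm k)

section runGraph

variable {n : ℕ} {e : RunCoord ι ≃ Fin n} {q : ℝ} {m : ℕ} {x : ℕ → ι → ℝ}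

theorem runGraph_neighSum {j : ℕ} (hj : j < m) (o : Option (Option ι)) :
    (runGraph e q m x).neighSum (⟨j, by omega⟩ : Fin (m + 1)) (e (.inr ((j : ZMod 3) + 1, o))) =
      runLabel q m x (j + 1) (.inr ((j : ZMod 3) + 1, o)) := by
  rw [LabeledGraph.neighSum, Finset.sum_eq_single (⟨j + 1, by omega⟩ : Fin (m + 1))]
  · simp
  · intro (i : Fin (m + 1)) hi hij
    have hadj : j + 1 = (i : ℕ) ∨ (i : ℕ) + 1 = j := by simpa using hi
    obtain rfl : (i : ℕ) + 1 = j := hadj.resolve_left fun h => hij (Fin.ext h.symm)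
    have : ∀ c : ZMod 3, c ≠ c + 1 + 1 := by decide
    simp [runLabel, this]
  · simp

theorem runGraph_isRunNode (hstart : x 0 = fun i => a i + b i * q)
    (hstep : ∀ i < m, step (x i) (x (i + 1))) (hhalt : halt (x m)) (v : (runGraph e q m x).V) :
    IsRunNode step halt a b (fun k => (runGraph e q m x).label v (e k))
      fun k => (runGraph e q m x).neighSum v (e k) := by
  obtain ⟨j, hj⟩ : Fin (m + 1) := v
  refine ⟨j, ?_, ?_, ?_, ?_⟩
  · simp [runLabel]
  · intro d hd o
    simp [runLabel, hd.symm]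
  · obtain rfl | hj₀ := eq_or_ne j 0
    · exact .inr fun i => by simp [runLabel, hstart]
    · exact .inl <| by simp [runLabel, hj₀]
  · obtain rfl | hjm := Nat.eq_or_lt_of_le (Nat.lt_succ_iff.1 hj)
    · exact .inl <| by simpa [runLabel] using hhalt
    · refine .inr ⟨?_, ?_, ?_⟩
      · simp [runGraph_neighSum hjm, runLabel]
      · suffices (m : ℝ) - (j + 1) + 1 ≤ m - j by simpa [runGraph_neighSum hjm, runLabel] using this
        linarith
      · simpa [runGraph_neighSum hjm, runLabel] using hstep j hjm

theorem one_le_runGraph_totalSum_root : 1 ≤ (runGraph e q m x).totalSum (e root) := by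
  have h : (runGraph e q m x).label (0 : Fin (m + 1)) (e root) = 1 := by simp [runLabel]
  rw [← h]
  refine Finset.single_le_sum (f := fun v => (runGraph e q m x).label v (e root))
    (fun v _ => ?_) (Finset.mem_univ (0 : Fin (m + 1)))
  simp only [runLabel, Equiv.symm_apply_apply]
  positivity

end runGraph

/-- The program that says that `φ` holds at all nodes, coordinate `i` is `q` at all nodes, and the
sum of coordinate `j` is at least `1`. -/
def inputProgram {n : ℕ} (i j : Fin n) (φ : NodeCond n) (q : ℚ) : Program where
  n := n
  graphCond := .le (Pi.single j (-1)) (-1)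
  nodeCond := .and (.le (Pi.single i 1) 0 q) (.and (.le (Pi.single i (-1)) 0 (-q)) φ)

theorem inputProgram_satisfiable {n : ℕ} {i j : Fin n} {φ : NodeCond n} {q : ℚ} :
    (inputProgram i j φ q).Satisfiable ↔ ∃ G : LabeledGraph n, 1 ≤ G.totalSum j ∧
      ∀ v, G.label v i = q ∧ φ.Holds G v := by
  simp [Program.Satisfiable, inputProgram, GraphCond.Holds, NodeCond.Holds, sum_single_mul,
    le_antisymm_iff, and_assoc]

theorem primrec_inputProgram_code {n : ℕ} (i j : Fin n) (φ : NodeCond n) {q : ℕ → ℚ}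
    (hq : Primrec fun t => ratCode (q t)) (hq' : Primrec fun t => ratCode (-q t)) :
    Primrec fun t => (inputProgram i j φ (q t)).code := by
  obtain ⟨l₁, l₂, l₃, h⟩ : ∃ l₁ l₂ l₃ : List ℕ, ∀ q,
      (inputProgram i j φ q).code = l₁ ++ (ratCode q ++ (l₂ ++ (ratCode (-q) ++ l₃))) := by
    refine ⟨n :: (GraphCond.code (.le (Pi.single j (-1)) (-1)) ++
      1 :: 0 :: (vecCode (Pi.single i 1 : Fin n → ℚ) ++ vecCode (0 : Fin n → ℚ))),
      1 :: 0 :: (vecCode (Pi.single i (-1) : Fin n → ℚ) ++ vecCode (0 : Fin n → ℚ)), φ.code,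
      fun q => ?_⟩
    simp [Program.code, inputProgram, NodeCond.code]
  simp only [h]
  exact Primrec.list_append.comp (.const l₁) <| Primrec.list_append.comp hq <|
    Primrec.list_append.comp (.const l₂) <| Primrec.list_append.comp hq' (.const l₃)

theorem exists_inputProgram_satisfiable_iff [Finite ι] (hs : IsPolyhedralRel step)
    (hh : IsPolyhedral halt) (a b : ι → ℚ) :
    ∃ (n : ℕ) (i j : Fin n) (φ : NodeCond n), ∀ q : ℚ, (inputProgram i j φ q).Satisfiable ↔
      Terminates step halt fun k => a k + b k * q := by
  obtain ⟨n, ⟨e⟩⟩ := Finite.exists_equiv_fin (RunCoord ι)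
  obtain ⟨φ, hφ⟩ := IsPolyhedral.exists_nodeCond <|
    (isPolyhedralRel_isRunNode (a := a) (b := b) hs hh).comp
      (fun k => .coord (.inl (e k))) fun k => .coord (.inr (e k))
  refine ⟨n, e input, e root, φ, fun q => ?_⟩
  simp only [inputProgram_satisfiable, hφ, Sum.elim_inl, Sum.elim_inr]
  constructor
  · rintro ⟨G, hroot, h⟩
    obtain ⟨v, -, hv⟩ := Finset.exists_ne_zero_of_sum_ne_zero (one_pos.trans_le hroot).ne'
    exact terminates_of_isRunNode (fun v => (h v).2) ⟨v, hv⟩ fun v => (h v).1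
  · rintro ⟨z, hz, hzh⟩
    obtain ⟨m, x, hx₀, rfl, hx⟩ := exists_seq_of_reflTransGen hz
    exact ⟨runGraph e q m x, one_le_runGraph_totalSum_root,
      fun v => ⟨by simp [runLabel], runGraph_isRunNode hx₀ hx hzh v⟩⟩

end Run

/-! ### Stack machines -/

section StackCode

variable {α : Type*} [Fintype α]

/-- The digit that stands for the top symbol of a stack; the digit `0` stands for no symbol. -/
noncomputable def symbolCode : Option α → ℕ
  | none => 0
  | some a => Fintype.equivFin α a + 1

variable (α) in
/-- The base of the expansion that encodes stacks over `α`, large enough that the tail of a stack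
contributes at most `1 / 2` to the encoding. -/
def stackBase : ℕ := 2 * (Fintype.card α + 1)

/-- The rational number whose expansion in base `stackBase α` has the symbols of a stack as
digits, the top symbol before the point. -/
noncomputable def stackCode : List α → ℚ
  | [] => 0
  | a :: s => symbolCode (some a) + (stackBase α : ℚ)⁻¹ * stackCode s

/-- The polyhedral condition on the encoding of a stack that says that its top symbol is `o`. -/
def HeadIs (o : Option α) (x : ℝ) : Prop :=
  symbolCode o ≤ x ∧ x ≤ symbolCode o + ((1 / 2 : ℚ) : ℝ)

theorem symbolCode_injective : Injective (symbolCode (α := α)) := by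
  rintro (_ | a) (_ | b) h <;> simp_all [symbolCode, Fin.val_inj]

theorem symbolCode_le_card (o : Option α) : symbolCode o ≤ Fintype.card α := by
  cases o with
  | none => exact Nat.zero_le _
  | some a => exact (Fintype.equivFin α a).isLt

theorem one_lt_stackBase : 1 < stackBase α := by
  rw [stackBase]
  omega

theorem stackCode_eq_head_add_tail (s : List α) :
    stackCode s = symbolCode s.head? + (stackBase α : ℚ)⁻¹ * stackCode s.tail := by
  cases s <;> simp [stackCode, symbolCode]

theorem stackCode_nonneg (s : List α) : 0 ≤ stackCode s := by
  induction s with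
  | nil => exact le_rfl
  | cons a s ih => exact add_nonneg (Nat.cast_nonneg _) (mul_nonneg (by positivity) ih)

theorem inv_stackBase_mul_stackCode_le (s : List α) :
    (stackBase α : ℚ)⁻¹ * stackCode s ≤ 1 / 2 := by
  induction s with
  | nil => norm_num [stackCode]
  | cons a s ih =>
    rw [inv_mul_le_iff₀ (Nat.cast_pos.2 (one_pos.trans one_lt_stackBase)), stackCode]
    have : (symbolCode (some a) : ℚ) ≤ Fintype.card α := mod_cast symbolCode_le_card _
    push_cast [stackBase] at ih ⊢
    linarith

theorem headIs_stackCode_iff {o : Option α} {s : List α} :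
    HeadIs o (stackCode s : ℝ) ↔ s.head? = o := by
  have h₀ := mul_nonneg (by positivity : 0 ≤ (stackBase α : ℚ)⁻¹) (stackCode_nonneg s.tail)
  have h₁ := inv_stackBase_mul_stackCode_le s.tail
  rw [HeadIs, stackCode_eq_head_add_tail]
  norm_cast
  constructor
  · rintro ⟨h₂, h₃⟩
    refine symbolCode_injective (le_antisymm ?_ ?_) <;> rw [← Nat.lt_succ_iff] <;>
      refine (Nat.cast_lt (α := ℚ)).1 ?_ <;> push_cast <;> linarith
  · rintro rfl
    constructor <;> linarith

theorem stackCode_tail (s : List α) :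
    stackCode s.tail = stackBase α * (stackCode s - symbolCode s.head?) := by
  have : (stackBase α : ℚ) ≠ 0 := Nat.cast_ne_zero.2 (one_pos.trans one_lt_stackBase).ne'
  rw [stackCode_eq_head_add_tail s]
  field_simp
  ring

theorem exists_stackCode_replicate_append (a : α) : ∃ r : ℚ, ∀ t s,
    stackCode (List.replicate t a ++ s) =
      r + (stackCode s - r) * ((stackBase α ^ t : ℕ) : ℚ)⁻¹ := by
  -- `r` is the encoding of an infinite stack of symbols `a`.
  obtain ⟨r, hr⟩ : ∃ r : ℚ, r = symbolCode (some a) + (stackBase α : ℚ)⁻¹ * r := by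
    have hB : 1 - (stackBase α : ℚ)⁻¹ ≠ 0 :=
      sub_ne_zero.2 (inv_ne_one.2 (Nat.cast_ne_one.2 one_lt_stackBase.ne')).symm
    refine ⟨symbolCode (some a) / (1 - (stackBase α : ℚ)⁻¹), ?_⟩
    rw [← sub_eq_iff_eq_add, ← one_sub_mul, mul_div_cancel₀ _ hB]
  refine ⟨r, fun t s => ?_⟩
  induction t with
  | zero => simp
  | succ t ih =>
    rw [List.replicate_succ, List.cons_append, stackCode, ih]
    push_cast [pow_succ, mul_inv]
    linear_combination -hr

end StackCode

section StackMachine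

open Turing

variable {K Λ σ : Type*} {Γ : K → Type*} [∀ k, Fintype (Γ k)]

/-- The encodings of all stacks of a machine. -/
noncomputable def stackVec (S : ∀ k, List (Γ k)) (k : K) : ℝ := stackCode (S k)

/-- The encoding of a configuration of a stack machine as a vector; `c` numbers the pairs of a
label and an internal state. -/
noncomputable def cfgVec (c : Option Λ × σ → ℕ) (C : TM2.Cfg Γ Λ σ) : Option K → ℝ
  | none => c (C.l, C.var)
  | some k => stackVec C.stk k

theorem exists_isPolyhedralRel_cfgVec [Finite K] (c : Option Λ × σ → ℕ) (l : Option Λ) (v : σ) :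
    ∃ r : (K → ℝ) → (Option K → ℝ) → Prop, IsPolyhedralRel r ∧
      ∀ (S : ∀ k, List (Γ k)) y, r (stackVec S) y ↔ y = cfgVec c ⟨l, v, S⟩ :=
  ⟨fun x y => y none = c (l, v) ∧ ∀ k, y (some k) = x k,
    .and (.eq (.coord _) (.natCast _)) (.forall_finite fun _ => .eq (.coord _) (.coord _)),
    fun S y => by rw [funext_iff, Option.forall]; rfl⟩

variable {L : Finset Λ} {c : Option Λ × σ → ℕ}

theorem cfgVec_none_eq_iff (hc : Set.InjOn c (L.insertNone ×ˢ Set.univ)) {C : TM2.Cfg Γ Λ σ}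
    (hC : C.l ∈ L.insertNone) {l : Option Λ} (hl : l ∈ L.insertNone) {v : σ} :
    cfgVec c C none = c (l, v) ↔ C.l = l ∧ C.var = v := by
  rw [cfgVec, Nat.cast_inj, hc.eq_iff ⟨hC, trivial⟩ ⟨hl, trivial⟩, Prod.mk.injEq]

variable [DecidableEq K]

theorem stackVec_update (S : ∀ k, List (Γ k)) (k : K) (s : List (Γ k)) :
    stackVec (update S k s) = update (stackVec S) k (stackCode s : ℝ) :=
  funext (apply_update (fun _ s => (stackCode s : ℝ)) S k s)

theorem isPolyhedral_headIs {α ι : Type*} [Fintype α] (o : Option α) (i : ι) :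
    IsPolyhedral fun x : ι → ℝ => HeadIs o (x i) :=
  .and (.le (.natCast _) (.coord i)) (.le (.coord i) (.add (.natCast _) (.const _)))

theorem exists_isPolyhedralRel_stepAux [Finite K] (c : Option Λ × σ → ℕ) (q : TM2.Stmt Γ Λ σ)
    (v : σ) : ∃ r : (K → ℝ) → (Option K → ℝ) → Prop, IsPolyhedralRel r ∧
      ∀ S y, r (stackVec S) y ↔ y = cfgVec c (TM2.stepAux q v S) := by
  induction q generalizing v with
  | push k f q ih =>
    obtain ⟨r, hr, h⟩ := ih v
    refine ⟨fun x => r (update x k (symbolCode (some (f v)) +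
      ((stackBase (Γ k) : ℚ)⁻¹ : ℚ) * x k)),
      hr.comp (.update (fun _ => .coord _) k (.add (.natCast _) (.smul _ (.coord _))))
        fun _ => .coord _, fun S y => ?_⟩
    rw [TM2.stepAux, ← h, stackVec_update]
    simp [stackCode, stackVec]
  | peek k f q ih =>
    choose r hr h using ih
    refine ⟨fun x y => ∃ o, HeadIs o (x k) ∧ r (f v o) x y,
      .exists_finite fun o => (isPolyhedral_headIs o _).and (hr _), fun S y => ?_⟩
    simp [h, stackVec, headIs_stackCode_iff]
  | pop k f q ih =>
    choose r hr h using ih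
    refine ⟨fun x y => ∃ o, HeadIs o (x k) ∧
      r (f v o) (update x k ((stackBase (Γ k) : ℚ) * (x k - symbolCode o))) y,
      .exists_finite fun o => (isPolyhedral_headIs o _).and <| (hr _).comp
        (.update (fun _ => .coord _) k (.smul _ (.sub (.coord _) (.natCast _))))
        fun _ => .coord _, fun S y => ?_⟩
    rw [TM2.stepAux, ← h, stackVec_update, stackCode_tail]
    simp [stackVec, headIs_stackCode_iff]
  | load f _ ih => exact ih (f v)
  | branch f q₁ q₂ ih₁ ih₂ =>
    cases hv : f v
    · simpa [hv] using ih₂ v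
    · simpa [hv] using ih₁ v
  | goto f => exact exists_isPolyhedralRel_cfgVec c _ v
  | halt => exact exists_isPolyhedralRel_cfgVec c _ v

theorem exists_isPolyhedralRel_step [Finite K] [Finite σ] (M : Λ → TM2.Stmt Γ Λ σ)
    (hc : Set.InjOn c (L.insertNone ×ˢ Set.univ)) :
    ∃ step : (Option K → ℝ) → (Option K → ℝ) → Prop, IsPolyhedralRel step ∧
      ∀ {C : TM2.Cfg Γ Λ σ}, C.l ∈ L.insertNone →
        ∀ y, step (cfgVec c C) y ↔ ∃ C', C' ∈ TM2.step M C ∧ y = cfgVec c C' := by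
  choose r hr hrS using fun l => exists_isPolyhedralRel_stepAux c (M l)
  refine ⟨fun x y => ∃ p : L × σ, x none = c (some p.1, p.2) ∧
    r p.1 p.2 (fun k => x (some k)) y, .exists_finite fun p => .and (.eq (.coord _) (.natCast _))
      ((hr _ _).comp (fun _ => .coord _) fun _ => .coord _), fun {C} hC y => ?_⟩
  have hL (l : L) : some (l : Λ) ∈ L.insertNone := Finset.some_mem_insertNone.2 l.2
  obtain ⟨_ | l, v, T⟩ := C
  · refine iff_of_false ?_ (by simp)
    rintro ⟨⟨l, w⟩, hl, -⟩
    exact Option.some_ne_none _ ((cfgVec_none_eq_iff hc hC (hL l)).1 hl).1.symm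
  · constructor
    · rintro ⟨⟨l', w⟩, hl, hy⟩
      obtain ⟨⟨⟩, rfl⟩ := (cfgVec_none_eq_iff hc hC (hL l')).1 hl
      exact ⟨_, rfl, (hrS _ _ _ _).1 hy⟩
    · rintro ⟨_, ⟨⟩, hy⟩
      exact ⟨⟨⟨l, Finset.some_mem_insertNone.1 hC⟩, v⟩, rfl, (hrS _ _ _ _).2 hy⟩

theorem exists_isPolyhedral_halt [Finite σ] (M : Λ → TM2.Stmt Γ Λ σ)
    (hc : Set.InjOn c (L.insertNone ×ˢ Set.univ)) :
    ∃ halt : (Option K → ℝ) → Prop, IsPolyhedral halt ∧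
      ∀ {C : TM2.Cfg Γ Λ σ}, C.l ∈ L.insertNone → (halt (cfgVec c C) ↔ TM2.step M C = none) := by
  refine ⟨fun x => ∃ v, x none = c (none, v),
    .exists_finite fun v => .eq (.coord _) (.natCast _), fun {C} hC => ?_⟩
  simp only [cfgVec_none_eq_iff hc hC (by simp : none ∈ L.insertNone)]
  obtain ⟨_ | l, v, T⟩ := C <;> simp

theorem terminates_iff_eval_dom {α : Type*} {f : α → Option α} {a : α} :
    Terminates (fun a b => b ∈ f a) (fun b => f b = none) a ↔ (StateTransition.eval f a).Dom := by
  simp only [Part.dom_iff_mem, StateTransition.mem_eval]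
  rfl

theorem exists_terminates_cfgVec_iff [Finite K] [Finite σ] [Inhabited Λ]
    {M : Λ → TM2.Stmt Γ Λ σ} (hL : TM2.Supports M L) :
    ∃ (c : Option Λ × σ → ℕ) (step : (Option K → ℝ) → (Option K → ℝ) → Prop)
      (halt : (Option K → ℝ) → Prop), IsPolyhedralRel step ∧ IsPolyhedral halt ∧
      ∀ C : TM2.Cfg Γ Λ σ, C.l ∈ L.insertNone →
        (Terminates step halt (cfgVec c C) ↔ (StateTransition.eval (TM2.step M) C).Dom) := by
  obtain ⟨c, hc⟩ : ∃ c : Option Λ × σ → ℕ, Set.InjOn c (L.insertNone ×ˢ Set.univ) :=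
    Set.countable_iff_exists_injOn.1 (L.insertNone.finite_toSet.prod Set.finite_univ).countable
  obtain ⟨step, hstep, hs⟩ := exists_isPolyhedralRel_step M hc
  obtain ⟨halt, hhalt, hh⟩ := exists_isPolyhedral_halt M hc
  refine ⟨c, step, halt, hstep, hhalt, fun C hC => ?_⟩
  rw [← terminates_iff_eval_dom]
  exact terminates_map_iff (fun h h' => TM2.step_supports M hL h' h) hs hh hC

end StackMachine

/-! ### Undecidability -/

section Undecidability

open Turing PartrecToTM2

instance : Finite K' :=
  Fintype.finite ⟨{.main, .rev, .aux, .stack}, by rintro ⟨⟩ <;> simp⟩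

theorem trNat_two_mul {n : ℕ} (hn : n ≠ 0) : trNat (2 * n) = Γ'.bit0 :: trNat n := by
  have h : ((2 * n : ℕ) : Num) = (n : Num).bit0 := by
    rw [two_mul, Nat.cast_add, Num.bit0_of_bit0]
  rw [trNat, trNat, h]
  cases hm : (n : Num) with
  | zero => exact absurd (Num.of_nat_inj.1 hm) hn
  | pos m => rfl

theorem trNat_two_pow (t : ℕ) : trNat (2 ^ t) = List.replicate t Γ'.bit0 ++ [Γ'.bit1] := by
  induction t with
  | zero => rfl
  | succ t ih => rw [pow_succ', trNat_two_mul (by positivity), ih]; rfl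

theorem exists_cfgVec_init_two_pow (c : Option Λ' × Option Γ' → ℕ) (p : ToPartrec.Code) :
    ∃ a b : Option K' → ℚ, ∀ t : ℕ, cfgVec c (init p [2 ^ t]) =
      fun k => (a k : ℝ) + b k * (((stackBase Γ' ^ t : ℕ) : ℚ)⁻¹ : ℚ) := by
  obtain ⟨r, hr⟩ := exists_stackCode_replicate_append Γ'.bit0
  have hmain (t : ℕ) :
      trList [2 ^ t] = List.replicate t Γ'.bit0 ++ [Γ'.bit1, Γ'.cons] := by
    simp [trList, trNat_two_pow]
  refine ⟨fun
      | none => c (some (trNormal p .halt), none)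
      | some .main => r
      | some _ => 0,
    fun
      | some .main => stackCode [Γ'.bit1, Γ'.cons] - r
      | _ => 0,
    fun t => funext fun k => ?_⟩
  obtain _ | (_ | _ | _ | _) := k
  · simp [cfgVec, init]
  · simp only [cfgVec, stackVec, init, K'.elim, hmain, hr]
    norm_cast
  all_goals simp [cfgVec, stackVec, init, stackCode]

theorem exists_partrec_comp_eq {α β : Type*} [Primcodable α] [Primcodable β] {f : ℕ →. β}
    (hf : Partrec f) {e : ℕ → α} (he : Computable e) (hinj : Injective e) :
    ∃ g : α →. β, Partrec g ∧ ∀ t, g (e t) = f t := by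
  classical
  have hdec : Computable₂ fun m k => decide (e k = m) :=
    (Primrec.eq (α := α)).decide.to_comp.comp (he.comp .snd) .fst
  refine ⟨fun m => (Nat.rfind fun k => Part.some (decide (e k = m))).bind f,
    (Partrec.rfind hdec.partrec₂).bind (hf.comp .snd), fun t => ?_⟩
  have ht : t ∈ Nat.rfind fun k => Part.some (decide (e k = e t)) :=
    Nat.mem_rfind.2 ⟨by simp, fun hk => by simp [hinj.ne hk.ne]⟩
  exact (congrArg (Part.bind · f) (Part.eq_some_iff.2 ht)).trans (Part.bind_some t f)

theorem ratCode_inv_natCast {m : ℕ} (hm : m ≠ 0) : ratCode (m : ℚ)⁻¹ = [1, 0, m] := by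
  simp [ratCode, Int.sign_natCast_of_ne_zero hm, hm]

theorem ratCode_neg_inv_natCast {m : ℕ} (hm : m ≠ 0) : ratCode (-(m : ℚ)⁻¹) = [0, 1, m] := by
  simp [ratCode, Int.sign_natCast_of_ne_zero hm, hm]

theorem primrec_pow (b : ℕ) : Primrec fun t => b ^ t :=
  (Primrec₂.unpaired'.1 Nat.Primrec.pow).comp (.const b) .id

theorem exists_program_satisfiable_iff_dom {f : ℕ →. ℕ} (hf : Partrec f) :
    ∃ P : ℕ → Program, (Computable fun t => (P t).code) ∧
      ∀ t, (P t).Satisfiable ↔ (f t).Dom := by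
  obtain ⟨g, hg, hgf⟩ := exists_partrec_comp_eq hf (primrec_pow 2).to_comp
    (Nat.pow_right_injective le_rfl)
  obtain ⟨p, hp⟩ := ToPartrec.Code.exists_code (Nat.Partrec'.part_iff₁.2 hg)
  let _ : Inhabited Λ' := ⟨trNormal p .halt⟩
  obtain ⟨c, step, halt, hs, hh, hdom⟩ := exists_terminates_cfgVec_iff (tr_supports p .halt)
  obtain ⟨a, b, hab⟩ := exists_cfgVec_init_two_pow c p
  obtain ⟨n, i, j, φ, hφ⟩ := exists_inputProgram_satisfiable_iff hs hh a b
  let B := stackBase Γ'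
  have hB (t : ℕ) : B ^ t ≠ 0 := (Nat.pow_pos (one_pos.trans one_lt_stackBase)).ne'
  refine ⟨fun t => inputProgram i j φ ((B ^ t : ℕ) : ℚ)⁻¹,
    (primrec_inputProgram_code i j φ ?_ ?_).to_comp, fun t => ?_⟩
  · simp only [ratCode_inv_natCast (hB _)]
    exact Primrec.list_cons.comp (.const 1) <| Primrec.list_cons.comp (.const 0) <|
      Primrec.list_cons.comp (primrec_pow B) (.const [])
  · simp only [ratCode_neg_inv_natCast (hB _)]
    exact Primrec.list_cons.comp (.const 0) <| Primrec.list_cons.comp (.const 1) <|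
      Primrec.list_cons.comp (primrec_pow B) (.const [])
  · have hl : (init p [2 ^ t]).l ∈ (codeSupp p .halt).insertNone :=
      Finset.some_mem_insertNone.2 (codeSupp_self p .halt (trStmts₁_self _))
    have hcode := hp ⟨[2 ^ t], rfl⟩
    rw [hφ, ← hab, hdom _ hl, tr_eval, hcode, ← hgf]
    rfl

end Undecidability

end GLP

/-- Graph Linear Programming is undecidable. -/
theorem theorem3 : ¬ GLP.IsDecidable GLP.Program.code GLP.Program.Satisfiable := by
  rintro ⟨g, hg, h⟩
  have hf : Partrec fun n : ℕ => (Denumerable.ofNat Nat.Partrec.Code n).eval 0 :=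
    Nat.Partrec.Code.eval_part.comp (Computable.ofNat _) (Computable.const 0)
  obtain ⟨P, hP, hPf⟩ := GLP.exists_program_satisfiable_iff_dom hf
  refine ComputablePred.halting_problem 0 (ComputablePred.computable_iff.2
    ⟨fun c => g (P (Encodable.encode c)).code, hg.comp (hP.comp Computable.encode), ?_⟩)
  ext c
  simp [h, hPf]
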